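/- **Setting.** Let $X=X_1\times\cdots\times X_n\subset\mathbb R^n$ (with $X_l\subset\mathbb R$) be nonempty, compact and convex, $a\in\mathbb R^n$, $d\in\mathbb R^m$, $E\in\mathbb R^{p\times n}$, $F\in\mathbb Z^{p\times m}$, $h\in\mathbb R^p$, $y^\ell,y^u\in\mathbb Z^m$ be the data of the MILP of minimising $a^Tx+d^T\tilde y$ over $x\in X$, $\tilde y\in\mathbb Z^m$ subject to $Ex+F\tilde y\le h$, $y^\ell\le\tilde y\le y^u$. Let $\omega_i=0$ if row $i$ of $E$ is nonzero, and otherwise let $\omega_i$ be the gcd of the nonzero entries of row $i$ of $F$ ($0$ if there are none). Let $b_i$ be the largest element of $\omega_i\mathbb Z$ not exceeding $h_i$ ($b_i=h_i$ if $\omega_i=0$), let $\rho_i$ be the 1-norm of row $i$ of $F$, and let $\xi_e=\max\{(h_i-b_i)/\omega_i:\omega_i\ne0\}$ ($0$ if $\omega=0$). Fix $\xi\in[\xi_e,1)$, $\alpha,\delta>0$, $\phi\ge0$, and put $c=(a,d)$, $A=(E\ F)$, $\nu=\xi\omega-\frac12\rho$, $Z=X\times Y_\xi$ with $Y_\xi=\{y: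 y^\ell+(\frac12-\xi)\mathbf 1\le y\le y^u+(\xi-\frac12)\mathbf 1\}$, $r=\max_{z\in Z}\|z\|$, and $$L_\kappa(z,\lambda)=c^Tz+\tfrac\alpha2\|z\|^2+\lambda^T(Az-b-\nu-\phi\mathbf 1)-\tfrac\delta2\|\lambda\|^2 .$$ Assume Slater's condition: there is $\bar z=(\bar x,\bar y)\in X\times\mathbb R^m$ such that $E\bar x+F\bar y<b+\xi_e\omega-\frac12\rho$ and $y^\ell+(\frac12-\xi_e)\mathbf 1<\bar y<y^u+(\xi_e-\frac12)\mathbf 1$ componentwise. Let $$R=\frac{c^T\bar z+\frac\alpha2\|\bar z\|^2+\|c\|r}{\min_{1\le j\le p}(-A_j\bar z+b_j+\nu_j+\phi)},\qquad \Lambda=\{\lambda\in\mathbb R^p_+:\|\lambda\|_1\le R\}.$$ **Algorithm.** The coordinates of $z$ are distributed among $N_1$ primal agents (blocks $z_{[i]}$, with $Z_i$ the corresponding product of factors of $Z$) and those of $\lambda$ among $N_2$ dual agents (blocks $\lambda_{[q]}$, with $\Lambda_q=\{\lambda_{[q]}\ge0:\|\lambda_{[q]}\|_1\le R\}$). Let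 $B\ge1$, let $D\subseteq\{1,2,\dots\}$, and let $K^i\subseteq\{0,1,2,\dots\}$ be the update times of primal agent $i$; assume partial asynchrony: each $\{k,\dots,k+B-1\}$, $k\ge0$, meets every $K^i$. From any $z_{[i]}(0)\in Z_i$, $\lambda_{[q]}(0)\in\Lambda_q$, the algorithm with stepsizes $\gamma,\beta>0$ computes $$z_{[i]}(k+1)=\Pi_{Z_i}\big[z_{[i]}(k)-\gamma\nabla_{z_{[i]}}L_\kappa(z^i(k),\lambda^i(k))\big]\ (k\in K^i),\qquad z_{[i]}(k+1)=z_{[i]}(k)\ (k\notin K^i),$$ $$\lambda_{[q]}(tB)=\Pi_{\Lambda_q}\big[\lambda_{[q]}(tB-1)+\beta\nabla_{\lambda_{[q]}}L_\kappa(z^q(tB),\lambda^q(tB-1))\big]\ (t\in D),$$ and $\lambda_{[q]}$ is constant between these times. Here $z^i,\lambda^i$ and $z^q,\lambda^q$ are the copies stored by the agents. Every agent's copy of its own block is the true one. If some entry of $z_{[i]}$ appears with nonzero coefficient in some constraint of block $q$, then agent $i$'s copy of $\lambda_{[q]}$ is the current one at all times, and agent $q$'s copy of $z_{[i]}$ is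 the current one at the times $tB$, $t\in D$. All other stored entries are arbitrary. **Primal rate constants.** Call $(\gamma_1,\theta)$, with $\gamma_1,\theta>0$, *primal rate constants* if for every $\gamma\in(0,\gamma_1)$ one has $1-\theta\gamma\in[0,1)$ and, whenever the dual vector is held fixed at some $\lambda$ with all blocks $\lambda_{[q]}\in\Lambda_q$, the above partially asynchronous primal iteration satisfies $\|z(sB)-\hat z\|\le(1-\theta\gamma)^s\|z(0)-\hat z\|$ for all $s\ge0$ and all $z(0)\in Z$, where $\hat z=\operatorname{argmin}_{z\in Z}L_\kappa(z,\lambda)$. **Theorem (Dual Convergence to Optimum).** $L_\kappa$ has a unique saddle point $(\hat z_\kappa,\hat\lambda_\kappa)$ on $Z\times\Lambda$ (minimising in $z$, maximising in $\lambda$). For $\gamma\in(0,\gamma_1)$ and $\beta>0$ put $q_d=(1-\beta\delta)^2+\beta^2$ and $q_p=1-\theta\gamma$, and consider the assertion that $q_d,q_p\in[0,1)$ and that, for all update times and all runs of the algorithm as above, with $t_n$ the $n$-th element of $D$, $$\|\lambda(t_nB)-\hat\lambda_\kappa\|^2\le q_d^{\,n}\|\lambda(0)-\hat\lambda_\kappa\|^2+\big(4r^2q_dq_p^2\|A\|_2^2+8r^2\beta^2q_p\|A\|_2^2\big)\sum_{i=0}^nq_d^{\,i}.\qquad(*)$$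 1. For every pair $(\gamma_1,\theta)$ of primal rate constants, $(*)$ holds for all $\gamma\in(0,\gamma_1)$ and all $0<\beta<\min\left\{\frac{2\alpha}{\|A\|_2^2+2\alpha\delta},\frac{2\delta}{1+\delta^2}\right\}$. 2. There exist primal rate constants $(\gamma_1,\theta)$ such that $(*)$ holds for all $\gamma\in(0,\gamma_1)$ and all $0<\beta<\min\left\{\frac{2\alpha}{\|A\|_2+2\alpha\delta},\frac{2\delta}{1+\delta^2}\right\}$. -/

import Mathlib

open scoped Matrix.Norms.L2Operator

noncomputable section

/-! ### The mixed-integer linear program and its relaxation -/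

/-- Data of the program: minimise `aᵀx + dᵀy` over `x ∈ X = X₁ × ⋯ × Xₙ`, `y ∈ ℤᵐ`, subject to
`E x + F y ≤ h` and `yl ≤ y ≤ yu`. -/
structure MILP (n m p : ℕ) where
  a : Fin n → ℝ
  d : Fin m → ℝ
  E : Matrix (Fin p) (Fin n) ℝ
  F : Matrix (Fin p) (Fin m) ℤ
  h : Fin p → ℝ
  yl : Fin m → ℤ
  yu : Fin m → ℤ
  X : Fin n → Set ℝ

/-- Primal space: the vectors `z = (x, y)` of `ℝⁿ × ℝᵐ`, with the Euclidean norm. -/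
abbrev PVec (n m : ℕ) := EuclideanSpace ℝ (Fin n ⊕ Fin m)

/-- Dual space: the vectors `lam` of `ℝᵖ`, with the Euclidean norm. -/
abbrev DVec (p : ℕ) := EuclideanSpace ℝ (Fin p)

namespace MILP

variable {n m p : ℕ} (P : MILP n m p)

/-- The Cartesian product `X = X₁ × ⋯ × Xₙ`. -/
def setX : Set (EuclideanSpace ℝ (Fin n)) := {x | ∀ l, x l ∈ P.X l}

open Classical in
/-- `ωᵢ` is `0` if row `i` of `E` is nonzero, and otherwise the greatest common divisor of the
nonzero entries of row `i` of `F`. -/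
def omega (i : Fin p) : ℕ :=
  if P.E i = 0 then Finset.univ.gcd (fun j => (P.F i j).natAbs) else 0

/-- `⌊hᵢ⌋_{ωᵢ}`, the largest element of `ωᵢ ℤ` not exceeding `hᵢ`; it is `hᵢ` if `ωᵢ = 0`. -/
def b (i : Fin p) : ℝ :=
  if P.omega i = 0 then P.h i else (P.omega i : ℝ) * ⌊P.h i / (P.omega i : ℝ)⌋

/-- `ρᵢ`, the 1-norm of row `i` of `F`. -/
def rho (i : Fin p) : ℝ := ∑ j, |(P.F i j : ℝ)|

/-- `ξ_e = max {(hᵢ - ⌊hᵢ⌋_{ωᵢ}) / ωᵢ : ωᵢ ≠ 0}`, and `0` if `ω = 0`. The quotients are nonnegative,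
so that the rows with `ωᵢ = 0` may contribute the value `0`. -/
def xiE : ℝ := ⨆ i, if P.omega i = 0 then 0 else (P.h i - P.b i) / (P.omega i : ℝ)

/-- `A = (E F)`. -/
def A : Matrix (Fin p) (Fin n ⊕ Fin m) ℝ := Matrix.fromCols P.E (P.F.map (fun k : ℤ => (k : ℝ)))

/-- `c = (a, d)`. -/
def c : PVec n m := WithLp.toLp 2 (Sum.elim P.a P.d)

/-- `ν = ξ ω - ρ / 2`. -/
def nu (ξ : ℝ) (i : Fin p) : ℝ := ξ * (P.omega i : ℝ) - P.rho i / 2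

/-- The factors of `Z = X₁ × ⋯ × Xₙ × Y₁ × ⋯ × Yₘ`, where
`Yⱼ = [ylⱼ + (1/2 - ξ), yuⱼ + (ξ - 1/2)]`. -/
def Zc (ξ : ℝ) : Fin n ⊕ Fin m → Set ℝ
  | .inl l => P.X l
  | .inr j => Set.Icc ((P.yl j : ℝ) + (1 / 2 - ξ)) ((P.yu j : ℝ) + (ξ - 1 / 2))

/-- `Z = X × Y_ξ`. -/
def Z (ξ : ℝ) : Set (PVec n m) := {z | ∀ l, z l ∈ P.Zc ξ l}

/-- `z = (x, y)` satisfies `x ∈ X` and, strictly in every component, `g_ξ(x, y) < 0`, for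
`ξ = ξ_e`: it is a Slater point. -/
def IsSlaterPoint (z : PVec n m) : Prop :=
  (∀ l, z (.inl l) ∈ P.X l) ∧
  (∀ i, (∑ l, P.E i l * z (.inl l)) + (∑ j, (P.F i j : ℝ) * z (.inr j))
      - P.b i - P.xiE * (P.omega i : ℝ) + P.rho i / 2 < 0) ∧
  (∀ j, z (.inr j) - (P.yu j : ℝ) - (P.xiE - 1 / 2) < 0) ∧
  (∀ j, -z (.inr j) + (P.yl j : ℝ) + (1 / 2 - P.xiE) < 0)

end MILP

/-- The program, together with the parameter `ξ` of the relaxation, the regularization parameters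
`α`, `δ`, the constraint perturbation `φ`, and a point `zbar` (later: a Slater point). -/
structure SaddleProblem (n m p : ℕ) extends MILP n m p where
  ξ : ℝ
  α : ℝ
  δ : ℝ
  φ : ℝ
  zbar : PVec n m

namespace SaddleProblem

variable {n m p : ℕ} (S : SaddleProblem n m p)

/-- The perturbed constraint function `A z - b - ν - φ 1`. -/
def g (z : PVec n m) (j : Fin p) : ℝ :=
  (∑ l, S.A j l * z l) - S.b j - S.nu S.ξ j - S.φ

/-- The regularized Lagrangian
`L(z, lam) = cᵀz + α/2 ‖z‖² + lamᵀ(A z - b - ν - φ 1) - δ/2 ‖lam‖²`. -/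
def L (z : PVec n m) (lam : DVec p) : ℝ :=
  (∑ l, S.c l * z l) + S.α / 2 * ‖z‖ ^ 2 + (∑ j, lam j * S.g z j) - S.δ / 2 * ‖lam‖ ^ 2

/-- `r = max {‖z‖ : z ∈ Z}`. -/
def r : ℝ := sSup ((fun z => ‖z‖) '' S.Z S.ξ)

/-- The bound `(cᵀzbar + α/2 ‖zbar‖² + ‖c‖ r) / min_j (-A_j zbar + b_j + ν_j + φ)` on the 1-norm of
the multipliers. -/
def dualRadius : ℝ :=
  ((∑ l, S.c l * S.zbar l) + S.α / 2 * ‖S.zbar‖ ^ 2 + ‖S.c‖ * S.r) /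
    ⨅ j, -(∑ l, S.A j l * S.zbar l) + S.b j + S.nu S.ξ j + S.φ

/-- The compact set `Λ` of multipliers. -/
def Lam : Set (DVec p) := {lam | (∀ j, 0 ≤ lam j) ∧ ∑ j, |lam j| ≤ S.dualRadius}

/-- `(zh, lh) ∈ Z × Λ` is a saddle point of `L` on `Z × Λ`. -/
def IsSaddle (zh : PVec n m) (lh : DVec p) : Prop :=
  zh ∈ S.Z S.ξ ∧ lh ∈ S.Lam ∧ IsSaddlePointOn (S.Z S.ξ) S.Lam S.L zh lh

end SaddleProblem

/-! ### Blocks and projections -/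

/-- `y` is the Euclidean projection of `x` onto `s`, that is, a point of `s` nearest to `x`. -/
def IsProjOnto {V : Type*} [NormedAddCommGroup V] (s : Set V) (x y : V) : Prop :=
  y ∈ s ∧ ∀ w ∈ s, ‖x - y‖ ≤ ‖x - w‖

/-- Coordinates are distributed among agents by `own : ι → κ`; `block own i v` is the block of `v`
that belongs to agent `i`. -/
def block {ι κ : Type*} (own : ι → κ) (i : κ) (v : EuclideanSpace ℝ ι) :
    EuclideanSpace ℝ {l : ι // own l = i} :=
  WithLp.toLp 2 (fun l => v l.1)

namespace SaddleProblem

variable {n m p N₁ N₂ : ℕ} (S : SaddleProblem n m p)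
  (σ : Fin n ⊕ Fin m → Fin N₁) (τ : Fin p → Fin N₂)

/-- `Z_i`, the constraint set of the block of primal agent `i`. -/
def Zblock (i : Fin N₁) : Set (EuclideanSpace ℝ {l // σ l = i}) :=
  {w | ∀ l, w l ∈ S.Zc S.ξ l.1}

/-- `Λ_q`, the constraint set of the block of dual agent `q`. -/
def Lamblock (q : Fin N₂) : Set (EuclideanSpace ℝ {j // τ j = q}) :=
  {w | (∀ j, 0 ≤ w j) ∧ ∑ j, |w j| ≤ S.dualRadius}

/-- Primal agent `i` and dual agent `q` are essential neighbors: an entry of block `i` of `z` appears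
in a constraint belonging to block `q` of the multipliers. -/
def EssentialNeighbors (i : Fin N₁) (q : Fin N₂) : Prop :=
  ∃ l j, σ l = i ∧ τ j = q ∧ S.A j l ≠ 0

end SaddleProblem

/-- Partial asynchrony: among any `B` consecutive times, each agent `i` has one in `K i`. -/
def PartiallyAsync {N₁ : ℕ} (B : ℕ) (K : Fin N₁ → Set ℕ) : Prop :=
  ∀ i k, ∃ j ∈ K i, k ≤ j ∧ j < k + B

/-! ### The algorithm -/

/-- The values stored by the agents at each time: `zP i k`, `lP i k` are the primal and dual vectors
onboard primal agent `i` at time `k`, and `zD q k`, `lD q k` those onboard dual agent `q`. Only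
block `i` of `zP i` and block `q` of `lD q` are computed by the agents themselves. -/
structure AgentStates (n m p N₁ N₂ : ℕ) where
  zP : Fin N₁ → ℕ → PVec n m
  lP : Fin N₁ → ℕ → DVec p
  zD : Fin N₂ → ℕ → PVec n m
  lD : Fin N₂ → ℕ → DVec p

/-- The dual iterate `lam(k)`, assembled from the blocks held by the dual agents. -/
def AgentStates.lam {n m p N₁ N₂ : ℕ} (R : AgentStates n m p N₁ N₂) (τ : Fin p → Fin N₂)
    (k : ℕ) : DVec p :=
  WithLp.toLp 2 (fun j => R.lD (τ j) k j)

namespace SaddleProblem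

variable {n m p N₁ N₂ : ℕ} (S : SaddleProblem n m p)
  (σ : Fin n ⊕ Fin m → Fin N₁) (τ : Fin p → Fin N₂)

/-- `R` is produced by the asynchronous block primal-dual algorithm with stepsizes `γ`, `β`, where
primal agent `i` updates at the times in `K i` and the dual agents update at the times `t * B`,
`t ∈ D`. Stored values outside an agent's own block and outside the blocks of its essential
neighbors are arbitrary; they do not influence the blocks that the agent computes. -/
structure IsRun (B : ℕ) (γ β : ℝ) (K : Fin N₁ → Set ℕ) (D : Set ℕ)
    (R : AgentStates n m p N₁ N₂) : Prop where
  primal_init : ∀ i, block σ i (R.zP i 0) ∈ S.Zblock σ i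
  dual_init : ∀ q, block τ q (R.lD q 0) ∈ S.Lamblock τ q
  primal_update : ∀ i, ∀ k ∈ K i,
    IsProjOnto (S.Zblock σ i)
      (block σ i (R.zP i k) - γ • block σ i (gradient (fun z => S.L z (R.lP i k)) (R.zP i k)))
      (block σ i (R.zP i (k + 1)))
  primal_hold : ∀ i, ∀ k ∉ K i, block σ i (R.zP i (k + 1)) = block σ i (R.zP i k)
  dual_update : ∀ q, ∀ t ∈ D,
    IsProjOnto (S.Lamblock τ q)
      (block τ q (R.lD q (t * B - 1)) +
        β • block τ q (gradient (fun l => S.L (R.zD q (t * B)) l) (R.lD q (t * B - 1))))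
      (block τ q (R.lD q (t * B)))
  dual_hold : ∀ q k, (¬ ∃ t ∈ D, k + 1 = t * B) → block τ q (R.lD q (k + 1)) = block τ q (R.lD q k)
  primal_to_dual : ∀ i q, S.EssentialNeighbors σ τ i q → ∀ t ∈ D,
    block σ i (R.zD q (t * B)) = block σ i (R.zP i (t * B))
  dual_to_primal : ∀ i q, S.EssentialNeighbors σ τ i q → ∀ k,
    block τ q (R.lP i k) = block τ q (R.lD q k)

/-- `(γ₁, θ)` are constants of linear convergence of the partially asynchronous projected gradient
iteration of the primal agents while the dual vector is held fixed: for every stepsize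
`γ ∈ (0, γ₁)`, the number `1 - θ γ` lies in `[0, 1)`, and `s * B` time steps bring the primal iterate
closer to the minimiser of `L(·, lam)` on `Z` by the factor `(1 - θ γ) ^ s`, whatever the fixed
dual vector, the initial point and the update times. -/
def IsPrimalRate (B : ℕ) (γ₁ θ : ℝ) : Prop :=
  0 < γ₁ ∧ 0 < θ ∧ ∀ γ ∈ Set.Ioo 0 γ₁, 1 - θ * γ ∈ Set.Ico (0 : ℝ) 1 ∧
    ∀ lam : DVec p, (∀ q, block τ q lam ∈ S.Lamblock τ q) →
    ∀ K : Fin N₁ → Set ℕ, PartiallyAsync B K →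
    ∀ z : ℕ → PVec n m, z 0 ∈ S.Z S.ξ →
    ∀ s : ℕ,
    (∀ i, ∀ k < s * B,
      (k ∈ K i → IsProjOnto (S.Zblock σ i)
        (block σ i (z k) - γ • block σ i (gradient (fun w => S.L w lam) (z k)))
        (block σ i (z (k + 1)))) ∧
      (k ∉ K i → block σ i (z (k + 1)) = block σ i (z k))) →
    ∀ zh ∈ S.Z S.ξ, IsMinOn (fun w => S.L w lam) (S.Z S.ξ) zh →
      ‖z (s * B) - zh‖ ≤ (1 - θ * γ) ^ s * ‖z 0 - zh‖

/-- The convergence estimate of the dual iterates to `lh`, for all primal stepsizes `γ ∈ (0, γ₁)`, all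
dual stepsizes `0 < β < min {2α / (M + 2αδ), 2δ / (1 + δ²)}`, and all runs of the algorithm. If
`t ∈ D`, then `t = t_n`, the `n`-th element of `D`, for `n = |D ∩ {0, …, t}|`
(called `ν` below). -/
def DualEstimate (B : ℕ) (γ₁ θ M : ℝ) (lh : DVec p) : Prop :=
  ∀ γ ∈ Set.Ioo 0 γ₁, ∀ β : ℝ, 0 < β →
    β < min (2 * S.α / (M + 2 * S.α * S.δ)) (2 * S.δ / (1 + S.δ ^ 2)) →
  ∀ qd qp : ℝ, qd = (1 - β * S.δ) ^ 2 + β ^ 2 → qp = 1 - θ * γ →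
    qd ∈ Set.Ico (0 : ℝ) 1 ∧ qp ∈ Set.Ico (0 : ℝ) 1 ∧
    ∀ (K : Fin N₁ → Set ℕ) (D : Set ℕ), PartiallyAsync B K → 0 ∉ D →
    ∀ R : AgentStates n m p N₁ N₂, S.IsRun σ τ B γ β K D R →
    ∀ ν : ℕ, ∀ t ∈ D, (D ∩ Set.Iic t).ncard = ν →
      ‖R.lam τ (t * B) - lh‖ ^ 2 ≤
        qd ^ ν * ‖R.lam τ 0 - lh‖ ^ 2 +
          (4 * S.r ^ 2 * qd * qp ^ 2 * ‖S.A‖ ^ 2 + 8 * S.r ^ 2 * β ^ 2 * qp * ‖S.A‖ ^ 2) *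
            ∑ i ∈ Finset.range (ν + 1), qd ^ i

end SaddleProblem

end

noncomputable section

section Quadratic

variable {V : Type*} [NormedAddCommGroup V] [InnerProductSpace ℝ V]

/-- First-order optimality of a minimiser of a quadratic function on a convex set. -/
theorem inner_nonneg_of_forall_quadratic_le {s : Set V} (hs : Convex ℝ s) {q v : V} {α : ℝ}
    (hv : v ∈ s)
    (hmin : ∀ w ∈ s, inner ℝ q v + α / 2 * ‖v‖ ^ 2 ≤ inner ℝ q w + α / 2 * ‖w‖ ^ 2)
    {w : V} (hw : w ∈ s) : 0 ≤ inner ℝ (q + α • v) (w - v) := by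
  have key : ∀ t ∈ Set.Ioc (0 : ℝ) 1,
      0 ≤ inner ℝ (q + α • v) (w - v) + t * (α / 2 * ‖w - v‖ ^ 2) := by
    intro t ht
    have hmem : v + t • (w - v) ∈ s := hs.add_smul_sub_mem hv hw ⟨ht.1.le, ht.2⟩
    have h := hmin _ hmem
    rw [norm_add_sq_real, inner_add_right, inner_smul_right, norm_smul, mul_pow,
      Real.norm_eq_abs, sq_abs, inner_smul_right] at h
    have h2 : 0 ≤ t * (inner ℝ (q + α • v) (w - v) + t * (α / 2 * ‖w - v‖ ^ 2)) := by
      rw [inner_add_left, inner_smul_left]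
      simp only [conj_trivial]
      linarith
    exact nonneg_of_mul_nonneg_right h2 ht.1
  have hlim : Filter.Tendsto
      (fun t : ℝ => inner ℝ (q + α • v) (w - v) + t * (α / 2 * ‖w - v‖ ^ 2))
      (nhdsWithin 0 (Set.Ioi 0))
      (nhds (inner ℝ (q + α • v) (w - v) + 0 * (α / 2 * ‖w - v‖ ^ 2))) :=
    tendsto_nhdsWithin_of_tendsto_nhds (Continuous.tendsto (by fun_prop) 0)
  rw [zero_mul, add_zero] at hlim
  refine ge_of_tendsto hlim ?_
  filter_upwards [Ioc_mem_nhdsGT (zero_lt_one (α := ℝ))] with t ht using key t ht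

theorem IsProjOnto.inner_le_zero {s : Set V} (hs : Convex ℝ s) {x y : V} (h : IsProjOnto s x y)
    {w : V} (hw : w ∈ s) : inner ℝ (x - y) (w - y) ≤ 0 := by
  have := inner_nonneg_of_forall_quadratic_le hs (q := -x) (α := 1) h.1 (fun u hu => by
    have h1 := pow_le_pow_left₀ (norm_nonneg _) (h.2 u hu) 2
    rw [norm_sub_sq_real, norm_sub_sq_real] at h1
    rw [inner_neg_left, inner_neg_left]
    linarith) hw
  rw [one_smul, neg_add_eq_sub, ← neg_sub x y, inner_neg_left] at this
  linarith

theorem norm_le_of_sq_le_inner {v w : V} (h : ‖w‖ ^ 2 ≤ inner ℝ v w) : ‖w‖ ≤ ‖v‖ := by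
  have h1 := h.trans (real_inner_le_norm v w)
  rcases (norm_nonneg w).eq_or_lt with h0 | h0
  · rw [← h0]; exact norm_nonneg v
  · rw [sq] at h1; exact le_of_mul_le_mul_right h1 h0

theorem gradient_quadratic [CompleteSpace V] (q v : V) (α k : ℝ) :
    gradient (fun w => inner ℝ q w + α / 2 * ‖w‖ ^ 2 + k) v = q + α • v := by
  apply HasGradientAt.gradient
  rw [hasGradientAt_iff_hasFDerivAt]
  have h1 : HasFDerivAt (fun w : V => inner ℝ q w) (innerSL ℝ q) v := (innerSL ℝ q).hasFDerivAt
  have h2 := ((hasStrictFDerivAt_norm_sq v).hasFDerivAt).const_mul (α / 2)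
  have h3 := (h1.add h2).add_const k
  refine h3.congr_fderiv ?_
  ext w
  simp
  ring

theorem convexOn_quadratic {s : Set V} (hs : Convex ℝ s) (q : V) {α : ℝ} (hα : 0 ≤ α) (k : ℝ) :
    ConvexOn ℝ s (fun w => inner ℝ q w + α / 2 * ‖w‖ ^ 2 + k) := by
  have h1 : ConvexOn ℝ s (fun w : V => inner ℝ q w) := (innerSL ℝ q).toLinearMap.convexOn hs
  have h2 : ConvexOn ℝ s (fun w : V => ‖w‖ ^ 2) :=
    (convexOn_norm hs).pow (fun _ _ => norm_nonneg _) 2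
  exact (h1.add (h2.smul (by positivity : (0 : ℝ) ≤ α / 2))).add_const k

/-- One step of regularised gradient ascent in the multipliers, with `e` the error of the inexact
primal minimiser and `u` the displacement of the exact one. -/
theorem sq_norm_dual_step_le {W : Type*} [NormedAddCommGroup W] [InnerProductSpace ℝ W]
    (T : W →ₗ[ℝ] V) {M α δ β r qp : ℝ} (hT : ∀ w, ‖T w‖ ≤ M * ‖w‖) (hM : 0 ≤ M)
    (hα : 0 < α) (hβ : 0 < β) (hr : 0 ≤ r)
    (hqp0 : 0 ≤ qp) {μ : V} {e u : W}
    (he : ‖e‖ ≤ 2 * r * qp) (hu : ‖u‖ ≤ 2 * r) (heu : ‖e + u‖ ≤ 2 * r)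
    (hmono : inner ℝ μ (T u) ≤ -(α * ‖u‖ ^ 2)) (hqd : (1 - β * δ) ^ 2 + β ^ 2 ≤ 1)
    (hcase : β * (M ^ 2 + 2 * α * δ) ≤ 2 * α ∨ 1 - qp ^ 2 ≤ 2 * β ^ 2 * qp) :
    ‖(1 - β * δ) • μ + β • T (e + u)‖ ^ 2 ≤ ((1 - β * δ) ^ 2 + β ^ 2) * ‖μ‖ ^ 2 +
      (4 * r ^ 2 * ((1 - β * δ) ^ 2 + β ^ 2) * qp ^ 2 * M ^ 2 +
        8 * r ^ 2 * β ^ 2 * qp * M ^ 2) := by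
  have hTsq : ∀ w, ‖T w‖ ^ 2 ≤ M ^ 2 * ‖w‖ ^ 2 := fun w => by
    rw [← mul_pow]; exact pow_le_pow_left₀ (norm_nonneg _) (hT w) 2
  have young : ∀ w : V, 2 * (β * ((1 - β * δ) * inner ℝ μ w)) ≤
      β ^ 2 * ‖μ‖ ^ 2 + (1 - β * δ) ^ 2 * ‖w‖ ^ 2 := fun w => by
    have h := sq_nonneg ‖β • μ - (1 - β * δ) • w‖
    rw [norm_sub_sq_real, norm_smul, norm_smul, mul_pow, mul_pow, Real.norm_eq_abs,
      Real.norm_eq_abs, sq_abs, sq_abs, inner_smul_left, inner_smul_right] at h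
    simp only [conj_trivial] at h
    linarith
  have hexp : ‖(1 - β * δ) • μ + β • T (e + u)‖ ^ 2 = (1 - β * δ) ^ 2 * ‖μ‖ ^ 2 +
      2 * (β * ((1 - β * δ) * inner ℝ μ (T (e + u)))) + β ^ 2 * ‖T (e + u)‖ ^ 2 := by
    rw [norm_add_sq_real, norm_smul, norm_smul, mul_pow, mul_pow, Real.norm_eq_abs,
      Real.norm_eq_abs, sq_abs, sq_abs, inner_smul_left, inner_smul_right]
    simp only [conj_trivial]
    ring
  rw [hexp]
  rcases hcase with hc | hc
  · have h1 : 0 ≤ 1 - β * δ := by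
      have : 0 ≤ β * M ^ 2 := by positivity
      by_contra hneg
      nlinarith
    have hTe : ‖T e‖ ≤ M * (2 * r * qp) := (hT e).trans (by gcongr)
    have hTu : ‖T u‖ ≤ M * (2 * r) := (hT u).trans (by gcongr)
    have hTe2 : ‖T e‖ ^ 2 ≤ (M * (2 * r * qp)) ^ 2 := by gcongr
    have hin : inner ℝ (T e) (T u) ≤ (M * (2 * r * qp)) * (M * (2 * r)) :=
      (real_inner_le_norm _ _).trans (by gcongr)
    have hTu2 := mul_le_mul_of_nonneg_left (hTsq u) (sq_nonneg β)
    have hy := young (T e)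
    have hm := mul_le_mul_of_nonneg_left hmono (mul_nonneg hβ.le h1)
    have hcu : 0 ≤ (2 * α - β * (M ^ 2 + 2 * α * δ)) * (β * ‖u‖ ^ 2) :=
      mul_nonneg (by linarith) (by positivity)
    have hq := mul_le_mul_of_nonneg_left hTe2
      (by positivity : 0 ≤ (1 - β * δ) ^ 2 + β ^ 2)
    have hb := mul_le_mul_of_nonneg_left hin (sq_nonneg β)
    rw [map_add, norm_add_sq_real, inner_add_right]
    linarith
  · have hw : ‖T (e + u)‖ ^ 2 ≤ M ^ 2 * (2 * r) ^ 2 := (hTsq _).trans (by gcongr)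
    have hy := young (T (e + u))
    have hq := mul_le_mul_of_nonneg_left hw (by positivity : 0 ≤ (1 - β * δ) ^ 2 + β ^ 2)
    have hfin : ((1 - β * δ) ^ 2 + β ^ 2) * (1 - qp ^ 2) ≤ 2 * β ^ 2 * qp := by
      rcases le_total 0 (1 - qp ^ 2) with h0 | h0
      · exact (mul_le_of_le_one_left h0 hqd).trans hc
      · exact (mul_nonpos_of_nonneg_of_nonpos (by positivity) h0).trans (by positivity)
    have := mul_le_mul_of_nonneg_left hfin (by positivity : 0 ≤ 4 * r ^ 2 * M ^ 2)
    linarith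

end Quadratic

section Blocks

variable {ι κ : Type*} (own : ι → κ)

@[simp] theorem block_apply (i : κ) (v : EuclideanSpace ℝ ι) (l : {l // own l = i}) :
    block own i v l = v l.1 := rfl

theorem block_add (i : κ) (v w : EuclideanSpace ℝ ι) :
    block own i (v + w) = block own i v + block own i w := rfl

theorem block_sub (i : κ) (v w : EuclideanSpace ℝ ι) :
    block own i (v - w) = block own i v - block own i w := rfl

theorem block_smul (i : κ) (a : ℝ) (v : EuclideanSpace ℝ ι) :
    block own i (a • v) = a • block own i v := rfl

theorem sum_inner_block [Fintype ι] [Fintype κ] [DecidableEq κ] (v w : EuclideanSpace ℝ ι) :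
    ∑ i, inner ℝ (block own i v) (block own i w) = inner ℝ v w := by
  simp only [PiLp.inner_apply, block_apply]
  exact Fintype.sum_fiberwise own (fun l => inner ℝ (v l) (w l))

theorem sum_sq_norm_block [Fintype ι] [Fintype κ] [DecidableEq κ] (v : EuclideanSpace ℝ ι) :
    ∑ i, ‖block own i v‖ ^ 2 = ‖v‖ ^ 2 := by
  simp only [← real_inner_self_eq_norm_sq]
  exact sum_inner_block own v v

theorem convex_nonneg_sum_abs_le [Fintype ι] (ρ : ℝ) :
    Convex ℝ {w : EuclideanSpace ℝ ι | (∀ j, 0 ≤ w j) ∧ ∑ j, |w j| ≤ ρ} := by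
  intro x hx y hy a b ha hb hab
  refine ⟨fun j => ?_, ?_⟩
  · have := mul_nonneg ha (hx.1 j)
    have := mul_nonneg hb (hy.1 j)
    simp only [PiLp.add_apply, PiLp.smul_apply, smul_eq_mul]
    linarith
  · calc ∑ j, |(a • x + b • y) j| ≤ ∑ j, (a * |x j| + b * |y j|) := by
          refine Finset.sum_le_sum fun j _ => ?_
          simp only [PiLp.add_apply, PiLp.smul_apply, smul_eq_mul]
          refine (abs_add_le _ _).trans ?_
          rw [abs_mul, abs_mul, abs_of_nonneg ha, abs_of_nonneg hb]
      _ = a * ∑ j, |x j| + b * ∑ j, |y j| := by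
          rw [Finset.sum_add_distrib, Finset.mul_sum, Finset.mul_sum]
      _ ≤ a * ρ + b * ρ := by
          gcongr
          · exact hx.2
          · exact hy.2
      _ = ρ := by rw [← add_mul, hab, one_mul]

end Blocks

namespace SaddleProblem

variable {n m p N₁ N₂ : ℕ} (S : SaddleProblem n m p)

/-- `z ↦ A z` on Euclidean spaces. -/
def Amap : PVec n m →ₗ[ℝ] DVec p := Matrix.toEuclideanLin S.A

/-- `lam ↦ Aᵀ lam` on Euclidean spaces. -/
def ATmap : DVec p →ₗ[ℝ] PVec n m := Matrix.toEuclideanLin S.A.transpose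

theorem Amap_apply (z : PVec n m) (j : Fin p) : S.Amap z j = ∑ l, S.A j l * z l := rfl

theorem ATmap_apply (lam : DVec p) (l : Fin n ⊕ Fin m) :
    S.ATmap lam l = ∑ j, S.A j l * lam j := rfl

theorem norm_Amap_le (z : PVec n m) : ‖S.Amap z‖ ≤ ‖S.A‖ * ‖z‖ :=
  S.A.l2_opNorm_mulVec z

theorem inner_ATmap (lam : DVec p) (z : PVec n m) :
    inner ℝ (S.ATmap lam) z = inner ℝ lam (S.Amap z) := by
  simp only [PiLp.inner_apply, ATmap_apply, Amap_apply, RCLike.inner_apply, conj_trivial,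
    Finset.mul_sum, Finset.sum_mul]
  rw [Finset.sum_comm]
  exact Finset.sum_congr rfl fun j _ => Finset.sum_congr rfl fun l _ => by ring

/-- The constraint function as a vector. -/
def gvec (z : PVec n m) : DVec p := WithLp.toLp 2 (S.g z)

theorem gvec_sub (z w : PVec n m) : S.gvec z - S.gvec w = S.Amap (z - w) := by
  ext j
  simp only [gvec, g, PiLp.sub_apply, map_sub, Amap_apply]
  ring

theorem L_eq_primal (z : PVec n m) (lam : DVec p) :
    S.L z lam = inner ℝ (S.c + S.ATmap lam) z + S.α / 2 * ‖z‖ ^ 2 +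
      (inner ℝ lam (S.gvec 0) - S.δ / 2 * ‖lam‖ ^ 2) := by
  have h1 : inner ℝ S.c z = ∑ l, S.c l * z l := by
    simp [PiLp.inner_apply, mul_comm]
  have h2 : ∑ j, lam j * S.g z j = inner ℝ lam (S.gvec z) := by
    simp [PiLp.inner_apply, gvec, mul_comm]
  have h3 : S.gvec z = S.Amap z + S.gvec 0 := by
    rw [← sub_eq_iff_eq_add, gvec_sub, sub_zero]
  rw [L, h2, h3, inner_add_left, inner_ATmap, ← h1, inner_add_right]
  ring

theorem L_eq_dual (z : PVec n m) (lam : DVec p) :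
    S.L z lam = -(inner ℝ (-S.gvec z) lam + S.δ / 2 * ‖lam‖ ^ 2 +
      -((∑ l, S.c l * z l) + S.α / 2 * ‖z‖ ^ 2)) := by
  have h2 : ∑ j, lam j * S.g z j = inner ℝ (S.gvec z) lam := by
    simp [PiLp.inner_apply, gvec]
  rw [L, h2, inner_neg_left]
  ring

theorem gradient_L_primal (z : PVec n m) (lam : DVec p) :
    gradient (fun w => S.L w lam) z = S.c + S.ATmap lam + S.α • z := by
  simp only [L_eq_primal]
  exact gradient_quadratic _ _ _ _

theorem gradient_L_dual (z : PVec n m) (lam : DVec p) :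
    gradient (fun l => S.L z l) lam = S.gvec z - S.δ • lam := by
  have h : (fun l => S.L z l) = fun l => inner ℝ (S.gvec z) l + (-S.δ) / 2 * ‖l‖ ^ 2 +
      ((∑ l, S.c l * z l) + S.α / 2 * ‖z‖ ^ 2) := by
    funext l
    rw [L_eq_dual, inner_neg_left]
    ring
  rw [h, gradient_quadratic, neg_smul, sub_eq_add_neg]

theorem continuous_L_primal (lam : DVec p) : Continuous fun z => S.L z lam := by
  simp only [L_eq_primal]
  fun_prop

theorem continuous_L_dual (z : PVec n m) : Continuous fun lam => S.L z lam := by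
  simp only [L_eq_dual]
  fun_prop

theorem inner_nonneg_of_isMinOn {lam : DVec p} (hZ : Convex ℝ (S.Z S.ξ)) {zh : PVec n m}
    (hzh : zh ∈ S.Z S.ξ) (hmin : IsMinOn (fun w => S.L w lam) (S.Z S.ξ) zh)
    {w : PVec n m} (hw : w ∈ S.Z S.ξ) :
    0 ≤ inner ℝ (S.c + S.ATmap lam + S.α • zh) (w - zh) := by
  refine inner_nonneg_of_forall_quadratic_le hZ hzh (fun w hw => ?_) hw
  have := hmin hw
  simp only [Set.mem_ofPred_eq, L_eq_primal] at this
  linarith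

theorem inner_nonpos_of_isMaxOn {s : Set (DVec p)} (hs : Convex ℝ s) {z : PVec n m} {lh : DVec p}
    (hlh : lh ∈ s) (hmax : ∀ lam ∈ s, S.L z lam ≤ S.L z lh) {lam : DVec p} (hlam : lam ∈ s) :
    inner ℝ (S.gvec z - S.δ • lh) (lam - lh) ≤ 0 := by
  have h := inner_nonneg_of_forall_quadratic_le hs (q := -S.gvec z) (α := S.δ) hlh (fun w hw => by
    have := hmax w hw
    rw [L_eq_dual, L_eq_dual] at this
    linarith) hlam
  rw [neg_add_eq_sub, ← neg_sub, inner_neg_left] at h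
  linarith

/-- Strong monotonicity of the minimiser of the Lagrangian in the multipliers. -/
theorem inner_Amap_sub_le (hZ : Convex ℝ (S.Z S.ξ)) {lam mu : DVec p} {z w : PVec n m}
    (hz : z ∈ S.Z S.ξ) (hw : w ∈ S.Z S.ξ) (hzmin : IsMinOn (fun w => S.L w lam) (S.Z S.ξ) z)
    (hwmin : IsMinOn (fun w => S.L w mu) (S.Z S.ξ) w) :
    inner ℝ (lam - mu) (S.Amap (z - w)) ≤ -(S.α * ‖z - w‖ ^ 2) := by
  have h1 := S.inner_nonneg_of_isMinOn hZ hz hzmin hw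
  have h2 := S.inner_nonneg_of_isMinOn hZ hw hwmin hz
  rw [← neg_sub z w, inner_neg_right] at h1
  have h3 : inner ℝ (S.c + S.ATmap lam + S.α • z) (z - w) -
      inner ℝ (S.c + S.ATmap mu + S.α • w) (z - w) =
      inner ℝ (lam - mu) (S.Amap (z - w)) + S.α * ‖z - w‖ ^ 2 := by
    rw [← inner_sub_left, ← inner_ATmap, ← real_inner_self_eq_norm_sq, ← real_inner_smul_left,
      ← inner_add_left, map_sub, smul_sub]
    congr 1
    abel
  linarith

/-- The product of the constraint sets of the dual agents. -/
def LamProd (τ : Fin p → Fin N₂) : Set (DVec p) := {lam | ∀ q, block τ q lam ∈ S.Lamblock τ q}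

variable {S}

theorem X_eq_image (hne : S.setX.Nonempty) (l : Fin n) : S.X l = (fun x => x l) '' S.setX := by
  obtain ⟨x, hx⟩ := hne
  ext a
  constructor
  · intro ha
    refine ⟨WithLp.toLp 2 (Function.update x l a), fun k => ?_, by simp⟩
    by_cases hk : k = l
    · subst hk; simpa using ha
    · simpa [hk] using hx k
  · rintro ⟨y, hy, rfl⟩
    exact hy l

theorem convex_Zc (hne : S.setX.Nonempty) (hconv : Convex ℝ S.setX) (l : Fin n ⊕ Fin m) :
    Convex ℝ (S.Zc S.ξ l) := by
  rcases l with l | j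
  · simp only [MILP.Zc, X_eq_image hne l]
    exact hconv.is_linear_image
      (f := fun x : EuclideanSpace ℝ (Fin n) => x l) ⟨fun _ _ => rfl, fun _ _ => rfl⟩
  · exact convex_Icc _ _

theorem isCompact_Zc (hne : S.setX.Nonempty) (hcpt : IsCompact S.setX) (l : Fin n ⊕ Fin m) :
    IsCompact (S.Zc S.ξ l) := by
  rcases l with l | j
  · simp only [MILP.Zc, X_eq_image hne l]
    exact hcpt.image (by fun_prop)
  · exact isCompact_Icc

theorem convex_Z (hne : S.setX.Nonempty) (hconv : Convex ℝ S.setX) : Convex ℝ (S.Z S.ξ) :=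
  fun _ hx _ hy _ _ ha hb hab l => convex_Zc hne hconv l (hx l) (hy l) ha hb hab

theorem convex_Zblock (hne : S.setX.Nonempty) (hconv : Convex ℝ S.setX)
    (σ : Fin n ⊕ Fin m → Fin N₁) (i : Fin N₁) : Convex ℝ (S.Zblock σ i) :=
  fun _ hx _ hy _ _ ha hb hab l => convex_Zc hne hconv l.1 (hx l) (hy l) ha hb hab

theorem isCompact_Z (hne : S.setX.Nonempty) (hcpt : IsCompact S.setX) : IsCompact (S.Z S.ξ) := by
  have h := (isCompact_univ_pi (isCompact_Zc hne hcpt)).image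
    (PiLp.continuous_toLp 2 (fun _ : Fin n ⊕ Fin m => ℝ))
  convert h using 1
  ext z
  constructor
  · exact fun hz => ⟨z.ofLp, fun l _ => hz l, rfl⟩
  · rintro ⟨y, hy, rfl⟩ l
    exact hy l (Set.mem_univ l)

theorem norm_le_r (hZ : IsCompact (S.Z S.ξ)) {z : PVec n m} (hz : z ∈ S.Z S.ξ) : ‖z‖ ≤ S.r :=
  le_csSup (hZ.image continuous_norm).bddAbove ⟨z, hz, rfl⟩

theorem norm_sub_le_two_r (hZ : IsCompact (S.Z S.ξ)) {z w : PVec n m} (hz : z ∈ S.Z S.ξ)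
    (hw : w ∈ S.Z S.ξ) : ‖z - w‖ ≤ 2 * S.r := by
  have := norm_sub_le z w
  linarith [norm_le_r hZ hz, norm_le_r hZ hw]

theorem convex_Lamblock (τ : Fin p → Fin N₂) (q : Fin N₂) : Convex ℝ (S.Lamblock τ q) :=
  convex_nonneg_sum_abs_le _

theorem convex_Lam : Convex ℝ S.Lam := convex_nonneg_sum_abs_le _

theorem convex_LamProd (τ : Fin p → Fin N₂) : Convex ℝ (S.LamProd τ) :=
  fun _ hx _ hy _ _ ha hb hab q => convex_Lamblock τ q (hx q) (hy q) ha hb hab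

theorem isCompact_LamProd (τ : Fin p → Fin N₂) : IsCompact (S.LamProd τ) := by
  have hclosed : IsClosed (S.LamProd τ) := by
    have : S.LamProd τ = ⋂ q, ({lam | ∀ j : {j // τ j = q}, 0 ≤ lam j.1} ∩
        {lam | ∑ j : {j // τ j = q}, |lam j.1| ≤ S.dualRadius}) := by
      ext lam
      simp only [Set.mem_iInter]
      exact Iff.rfl
    rw [this]
    refine isClosed_iInter fun q => IsClosed.inter ?_ ?_
    · rw [Set.ofPred_forall]
      exact isClosed_iInter fun j => isClosed_le continuous_const (by fun_prop)
    · exact isClosed_le (by fun_prop) continuous_const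
  have hsub : S.LamProd τ ⊆ WithLp.toLp 2 '' Set.univ.pi fun _ : Fin p =>
      Set.Icc 0 S.dualRadius := by
    intro lam hlam
    refine ⟨lam.ofLp, fun j _ => ⟨(hlam (τ j)).1 ⟨j, rfl⟩, ?_⟩, rfl⟩
    refine (le_abs_self _).trans (le_trans ?_ (hlam (τ j)).2)
    exact Finset.single_le_sum (f := fun k : {k // τ k = τ j} => |block τ (τ j) lam k|)
      (fun _ _ => abs_nonneg _) (Finset.mem_univ ⟨j, rfl⟩)
  exact ((isCompact_univ_pi fun _ => isCompact_Icc).image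
    (PiLp.continuous_toLp 2 (fun _ : Fin p => ℝ))).of_isClosed_subset hclosed hsub

theorem Lam_subset_LamProd (τ : Fin p → Fin N₂) : S.Lam ⊆ S.LamProd τ := by
  intro lam hlam q
  refine ⟨fun j => hlam.1 j.1, le_trans ?_ hlam.2⟩
  rw [← Fintype.sum_fiberwise τ (fun j => |lam j|)]
  exact Finset.single_le_sum
    (f := fun q => ∑ j : {j // τ j = q}, |lam j.1|)
    (fun _ _ => Finset.sum_nonneg fun _ _ => abs_nonneg _) (Finset.mem_univ q)

end SaddleProblem

namespace SaddleProblem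

variable {n m p N₁ N₂ : ℕ} {S : SaddleProblem n m p}

/-! ### Slater's condition and saddle points -/

theorem zbar_mem_Z (hslater : S.IsSlaterPoint S.zbar) (hξ : S.xiE ≤ S.ξ) : S.zbar ∈ S.Z S.ξ := by
  rintro (l | j)
  · exact hslater.1 l
  · have h1 := hslater.2.2.1 j
    have h2 := hslater.2.2.2 j
    exact ⟨by linarith, by linarith⟩

theorem g_zbar_neg (hslater : S.IsSlaterPoint S.zbar) (hξ : S.xiE ≤ S.ξ) (hφ : 0 ≤ S.φ)
    (j : Fin p) : S.g S.zbar j < 0 := by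
  have h := hslater.2.1 j
  have h1 : S.xiE * (S.omega j : ℝ) ≤ S.ξ * (S.omega j : ℝ) := by gcongr
  simp only [g, MILP.nu, MILP.A, Fintype.sum_sum_type, Matrix.fromCols_apply_inl,
    Matrix.fromCols_apply_inr, Matrix.map_apply]
  linarith

theorem slack_eq_neg_g (z : PVec n m) (j : Fin p) :
    -(∑ l, S.A j l * z l) + S.b j + S.nu S.ξ j + S.φ = -S.g z j := by
  rw [g]; ring

theorem cost_add_nonneg (hZ : IsCompact (S.Z S.ξ)) {z w : PVec n m} (hw : w ∈ S.Z S.ξ)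
    (hα : 0 < S.α) :
    0 ≤ (∑ l, S.c l * w l) + S.α / 2 * ‖z‖ ^ 2 + ‖S.c‖ * S.r := by
  have h1 : inner ℝ S.c w = ∑ l, S.c l * w l := by
    simp [PiLp.inner_apply, mul_comm]
  have h2 := neg_le_of_abs_le (abs_real_inner_le_norm S.c w)
  have h3 : ‖S.c‖ * ‖w‖ ≤ ‖S.c‖ * S.r := by gcongr; exact norm_le_r hZ hw
  have h4 : 0 ≤ S.α / 2 * ‖z‖ ^ 2 := by positivity
  linarith

theorem dualRadius_nonneg (hZ : IsCompact (S.Z S.ξ)) (hslater : S.IsSlaterPoint S.zbar)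
    (hξ : S.xiE ≤ S.ξ) (hα : 0 < S.α) (hφ : 0 ≤ S.φ) : 0 ≤ S.dualRadius := by
  refine div_nonneg (cost_add_nonneg hZ (zbar_mem_Z hslater hξ) hα) (Real.iInf_nonneg fun j => ?_)
  rw [slack_eq_neg_g]
  linarith [g_zbar_neg hslater hξ hφ j]

/-- The multipliers of a saddle point on a set containing `0` obey the Slater bound. -/
theorem mem_Lam_of_isSaddlePointOn (hZ : IsCompact (S.Z S.ξ))
    (hslater : S.IsSlaterPoint S.zbar) (hξ : S.xiE ≤ S.ξ) (hα : 0 < S.α) (hδ : 0 < S.δ)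
    (hφ : 0 ≤ S.φ) {s : Set (DVec p)} (h0 : (0 : DVec p) ∈ s) {zh : PVec n m} {lh : DVec p}
    (hzh : zh ∈ S.Z S.ξ) (hlh : ∀ j, 0 ≤ lh j)
    (hsad : IsSaddlePointOn (S.Z S.ξ) s S.L zh lh) : lh ∈ S.Lam := by
  refine ⟨hlh, ?_⟩
  have hz := zbar_mem_Z hslater hξ
  have hneg := g_zbar_neg hslater hξ hφ
  rcases isEmpty_or_nonempty (Fin p) with he | hne
  · rw [Finset.univ_eq_empty, Finset.sum_empty]
    exact dualRadius_nonneg hZ hslater hξ hα hφ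
  obtain ⟨k, hk⟩ := exists_eq_ciInf_of_finite (f := fun j =>
    -(∑ l, S.A j l * S.zbar l) + S.b j + S.nu S.ξ j + S.φ)
  have hle : ∀ j, -S.g S.zbar k ≤ -S.g S.zbar j := fun j => by
    rw [← slack_eq_neg_g, ← slack_eq_neg_g]
    rw [hk]
    exact ciInf_le (Set.finite_range _).bddBelow j
  rw [dualRadius, ← hk, slack_eq_neg_g, le_div_iff₀ (by linarith [hneg k]), Finset.sum_mul]
  have h := hsad _ hz _ h0
  have hcost := cost_add_nonneg (S := S) hZ (z := zh) hzh hα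
  have hsum : ∑ j, |lh j| * -S.g S.zbar k ≤ -∑ j, lh j * S.g S.zbar j := by
    rw [← Finset.sum_neg_distrib]
    refine Finset.sum_le_sum fun j _ => ?_
    rw [abs_of_nonneg (hlh j), ← mul_neg]
    exact mul_le_mul_of_nonneg_left (hle j) (hlh j)
  have hδ' : 0 ≤ S.δ / 2 * ‖lh‖ ^ 2 := by positivity
  have hz0 : ∑ j, (0 : DVec p) j * S.g zh j = 0 := by simp
  rw [L, L, hz0, norm_zero] at h
  linarith

theorem eq_of_isSaddle (hZ : Convex ℝ (S.Z S.ξ)) (hα : 0 < S.α) (hδ : 0 < S.δ)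
    {s : Set (DVec p)} (hs : Convex ℝ s) {z w : PVec n m} {lam mu : DVec p}
    (hz : z ∈ S.Z S.ξ) (hw : w ∈ S.Z S.ξ) (hlam : lam ∈ s) (hmu : mu ∈ s)
    (h1 : IsSaddlePointOn (S.Z S.ξ) s S.L z lam) (h2 : IsSaddlePointOn (S.Z S.ξ) s S.L w mu) :
    z = w ∧ lam = mu := by
  have hmin := S.inner_Amap_sub_le hZ hz hw (fun v hv => h1 v hv _ hlam) (fun v hv => h2 v hv _ hmu)
  have ha := S.inner_nonpos_of_isMaxOn hs hlam (fun l hl => h1 z hz l hl) hmu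
  have hb := S.inner_nonpos_of_isMaxOn hs hmu (fun l hl => h2 w hw l hl) hlam
  have hadd : inner ℝ (S.gvec z - S.δ • lam) (mu - lam) +
      inner ℝ (S.gvec w - S.δ • mu) (lam - mu) =
      -inner ℝ (lam - mu) (S.Amap (z - w)) + S.δ * ‖lam - mu‖ ^ 2 := by
    rw [← neg_sub lam mu, inner_neg_right, ← gvec_sub, ← real_inner_self_eq_norm_sq,
      ← real_inner_smul_left, real_inner_comm _ (lam - mu)]
    simp only [inner_sub_left, smul_sub]
    ring
  have hA : 0 ≤ S.α * ‖z - w‖ ^ 2 := by positivity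
  have hD : 0 ≤ S.δ * ‖lam - mu‖ ^ 2 := by positivity
  have hA0 : S.α * ‖z - w‖ ^ 2 = 0 := by linarith
  have hD0 : S.δ * ‖lam - mu‖ ^ 2 = 0 := by linarith
  refine ⟨?_, ?_⟩
  · simpa [hα.ne', sub_eq_zero] using hA0
  · simpa [hδ.ne', sub_eq_zero] using hD0

/-- There is a saddle point on `Z × Λ`, and it is a saddle point on `Z × ∏ Λ_q` as well. -/
theorem exists_isSaddle (τ : Fin p → Fin N₂) (hZ : IsCompact (S.Z S.ξ)) (hZc : Convex ℝ (S.Z S.ξ))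
    (hslater : S.IsSlaterPoint S.zbar) (hξ : S.xiE ≤ S.ξ) (hα : 0 < S.α) (hδ : 0 < S.δ)
    (hφ : 0 ≤ S.φ) :
    ∃ zh lh, S.IsSaddle zh lh ∧ IsSaddlePointOn (S.Z S.ξ) (S.LamProd τ) S.L zh lh := by
  have h0 : (0 : DVec p) ∈ S.LamProd τ := Lam_subset_LamProd τ
    ⟨fun _ => le_rfl, by simpa using dualRadius_nonneg hZ hslater hξ hα hφ⟩
  obtain ⟨zh, hzh, lh, hlh, hsad⟩ := Sion.exists_isSaddlePointOn (f := S.L)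
    ⟨_, zbar_mem_Z hslater hξ⟩ hZc hZ
    (fun lam _ => (S.continuous_L_primal lam).continuousOn.lowerSemicontinuousOn)
    (fun lam _ => by
      simp only [L_eq_primal]
      exact (convexOn_quadratic hZc _ hα.le _).quasiconvexOn)
    (convex_LamProd τ) ⟨0, h0⟩ (isCompact_LamProd τ)
    (fun z _ => (S.continuous_L_dual z).continuousOn.upperSemicontinuousOn)
    (fun z _ => by
      simp only [L_eq_dual]
      exact (convexOn_quadratic (convex_LamProd τ) _ hδ.le _).neg.quasiconcaveOn)
  have hmem := mem_Lam_of_isSaddlePointOn hZ hslater hξ hα hδ hφ h0 hzh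
    (fun j => (hlh (τ j)).1 ⟨j, rfl⟩) hsad
  exact ⟨zh, lh, ⟨hzh, hmem, fun z hz l hl => hsad z hz l (Lam_subset_LamProd τ hl)⟩, hsad⟩

/-! ### The primal iteration -/

theorem block_mem_Zblock {σ : Fin n ⊕ Fin m → Fin N₁} {z : PVec n m} (hz : z ∈ S.Z S.ξ)
    (i : Fin N₁) : block σ i z ∈ S.Zblock σ i := fun l => hz l.1

theorem mem_Z_of_block {σ : Fin n ⊕ Fin m → Fin N₁} {z : PVec n m}
    (hz : ∀ i, block σ i z ∈ S.Zblock σ i) : z ∈ S.Z S.ξ := fun l => hz (σ l) ⟨l, rfl⟩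

/-- First-order optimality in the block of one primal agent. -/
theorem block_inner_nonneg (σ : Fin n ⊕ Fin m → Fin N₁) (hZ : Convex ℝ (S.Z S.ξ)) {lam : DVec p}
    {zh : PVec n m} (hzh : zh ∈ S.Z S.ξ) (hmin : IsMinOn (fun w => S.L w lam) (S.Z S.ξ) zh)
    (i : Fin N₁) {w : EuclideanSpace ℝ {l // σ l = i}} (hw : w ∈ S.Zblock σ i) :
    0 ≤ inner ℝ (block σ i (S.c + S.ATmap lam + S.α • zh)) (w - block σ i zh) := by
  let v : PVec n m := WithLp.toLp 2 fun l => if h : σ l = i then w ⟨l, h⟩ else zh l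
  have hv : v ∈ S.Z S.ξ := fun l => by
    by_cases h : σ l = i
    · simpa [v, h] using hw ⟨l, h⟩
    · simpa [v, h] using hzh l
  have hvi : block σ i v = w := by
    ext l
    simp [v, l.2]
  have h := S.inner_nonneg_of_isMinOn hZ hzh hmin hv
  rw [← sum_inner_block σ, Finset.sum_eq_single i] at h
  · rwa [block_sub, hvi] at h
  · intro k _ hk
    have : block σ k (v - zh) = 0 := by
      ext l
      have : σ l.1 ≠ i := by rw [l.2]; exact hk
      simp [v, this]
    rw [this, inner_zero_right]
  · simp

/-- One projected gradient step of a primal agent is a contraction. -/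
theorem norm_block_step_le {σ : Fin n ⊕ Fin m → Fin N₁} (hZ : Convex ℝ (S.Z S.ξ)) {i : Fin N₁}
    (hZi : Convex ℝ (S.Zblock σ i)) {lam : DVec p} {zh z z' : PVec n m} (hzh : zh ∈ S.Z S.ξ)
    (hmin : IsMinOn (fun w => S.L w lam) (S.Z S.ξ) zh) {γ : ℝ} (hγ : 0 < γ) (hγα : γ * S.α ≤ 1)
    (hstep : IsProjOnto (S.Zblock σ i)
      (block σ i z - γ • block σ i (gradient (fun w => S.L w lam) z)) (block σ i z')) :
    ‖block σ i z' - block σ i zh‖ ≤ (1 - S.α * γ) * ‖block σ i z - block σ i zh‖ := by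
  have h1 := hstep.inner_le_zero hZi (block_mem_Zblock hzh i)
  have h2 := mul_nonneg hγ.le (S.block_inner_nonneg σ hZ hzh hmin i hstep.1)
  rw [gradient_L_primal] at h1
  have h3 := norm_le_of_sq_le_inner
    (v := (1 - S.α * γ) • (block σ i z - block σ i zh)) (w := block σ i z' - block σ i zh) (by
      rw [← real_inner_self_eq_norm_sq]
      rw [← neg_sub (block σ i z') (block σ i zh), inner_neg_right] at h1
      rw [← real_inner_smul_left] at h2
      have : inner ℝ ((1 - S.α * γ) • (block σ i z - block σ i zh)) (block σ i z' - block σ i zh) -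
          inner ℝ (block σ i z' - block σ i zh) (block σ i z' - block σ i zh) =
          inner ℝ (block σ i z - γ • block σ i (S.c + S.ATmap lam + S.α • z) - block σ i z')
            (block σ i z' - block σ i zh) +
          inner ℝ (γ • block σ i (S.c + S.ATmap lam + S.α • zh))
            (block σ i z' - block σ i zh) := by
        rw [← inner_sub_left, ← inner_add_left]
        congr 1
        simp only [block_add, block_smul, sub_smul, smul_sub, smul_add, one_smul, smul_smul,
          mul_comm γ S.α]
        abel
      linarith)
  rwa [norm_smul, Real.norm_of_nonneg (by linarith [mul_comm γ S.α])] at h3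

/-- A sequence that decreases, and contracts by `q` once in each window of length `B`. -/
theorem le_pow_mul_of_window {e : ℕ → ℝ} {q : ℝ} (hq0 : 0 ≤ q) (hq1 : q ≤ 1)
    (he : ∀ k, 0 ≤ e k) {B : ℕ} {K : Set ℕ} (hK : ∀ k, ∃ j ∈ K, k ≤ j ∧ j < k + B) (s : ℕ)
    (hup : ∀ k < s * B, k ∈ K → e (k + 1) ≤ q * e k)
    (hhold : ∀ k < s * B, k ∉ K → e (k + 1) = e k) : e (s * B) ≤ q ^ s * e 0 := by
  have hstep : ∀ k < s * B, e (k + 1) ≤ e k := fun k hk => by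
    by_cases hkK : k ∈ K
    · exact (hup k hk hkK).trans (mul_le_of_le_one_left (he k) hq1)
    · exact (hhold k hk hkK).le
  have hmono : ∀ a b, a ≤ b → b ≤ s * B → e b ≤ e a := by
    intro a b hab
    induction b, hab using Nat.le_induction with
    | base => exact fun _ => le_rfl
    | succ b _ ih => exact fun hb => (hstep b hb).trans (ih (Nat.le_of_succ_le hb))
  have main : ∀ t ≤ s, e (t * B) ≤ q ^ t * e 0 := by
    intro t
    induction t with
    | zero => simp
    | succ t ih =>
      intro ht
      obtain ⟨j, hjK, hj1, hj2⟩ := hK (t * B)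
      have hB : (t + 1) * B ≤ s * B := Nat.mul_le_mul_right B ht
      rw [Nat.succ_mul] at hB ⊢
      calc e (t * B + B) ≤ e (j + 1) := hmono _ _ hj2 hB
        _ ≤ q * e j := hup j (hj2.trans_le hB) hjK
        _ ≤ q * e (t * B) := by gcongr; exact hmono _ _ hj1 (hj2.le.trans hB)
        _ ≤ q * (q ^ t * e 0) := by gcongr; exact ih (Nat.le_of_succ_le ht)
        _ = q ^ (t + 1) * e 0 := by ring
  exact main s le_rfl

theorem isPrimalRate_of_le (σ : Fin n ⊕ Fin m → Fin N₁) (τ : Fin p → Fin N₂) (B : ℕ)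
    (hZ : Convex ℝ (S.Z S.ξ)) (hZi : ∀ i, Convex ℝ (S.Zblock σ i)) (hα : 0 < S.α) {γ₁ : ℝ}
    (hγ₁ : 0 < γ₁) (hle : S.α * γ₁ ≤ 1) : S.IsPrimalRate σ τ B γ₁ S.α := by
  refine ⟨hγ₁, hα, fun γ hγ => ?_⟩
  have hαγ : 0 < S.α * γ := mul_pos hα hγ.1
  have hαγ' : S.α * γ ≤ 1 := (mul_le_mul_of_nonneg_left hγ.2.le hα.le).trans hle
  refine ⟨⟨by linarith, by linarith⟩, ?_⟩
  intro lam _ K hK z _ s hrun zh hzh hmin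
  have hq0 : 0 ≤ 1 - S.α * γ := by linarith
  have hb : ∀ i, ‖block σ i (z (s * B) - zh)‖ ≤ (1 - S.α * γ) ^ s * ‖block σ i (z 0 - zh)‖ := by
    intro i
    refine le_pow_mul_of_window (e := fun k => ‖block σ i (z k - zh)‖) hq0 (by linarith)
      (fun _ => norm_nonneg _) (hK i) s (fun k hk hkK => ?_) (fun k hk hkK => ?_)
    · exact norm_block_step_le hZ (hZi i) hzh hmin hγ.1 (by linarith [mul_comm γ S.α])
        ((hrun i k hk).1 hkK)
    · simp only [block_sub, (hrun i k hk).2 hkK]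
  refine le_of_sq_le_sq ?_ (by positivity)
  rw [mul_pow, ← sum_sq_norm_block σ, ← sum_sq_norm_block σ (z 0 - zh), Finset.mul_sum]
  refine Finset.sum_le_sum fun i _ => ?_
  rw [← mul_pow]
  exact pow_le_pow_left₀ (norm_nonneg _) (hb i) 2

end SaddleProblem

/-- The primal iterate `z(k)`, assembled from the blocks held by the primal agents. -/
def AgentStates.z {n m p N₁ N₂ : ℕ} (R : AgentStates n m p N₁ N₂) (σ : Fin n ⊕ Fin m → Fin N₁)
    (k : ℕ) : PVec n m :=
  WithLp.toLp 2 (fun l => R.zP (σ l) k l)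

section

variable {n m p N₁ N₂ : ℕ} (R : AgentStates n m p N₁ N₂)

theorem AgentStates.block_z (σ : Fin n ⊕ Fin m → Fin N₁) (i : Fin N₁) (k : ℕ) :
    block σ i (R.z σ k) = block σ i (R.zP i k) := by
  ext ⟨l, rfl⟩
  rfl

theorem AgentStates.block_lam (τ : Fin p → Fin N₂) (q : Fin N₂) (k : ℕ) :
    block τ q (R.lam τ k) = block τ q (R.lD q k) := by
  ext ⟨j, rfl⟩
  rfl

theorem ext_block {ι κ : Type*} {own : ι → κ} {v w : EuclideanSpace ℝ ι}
    (h : ∀ i, block own i v = block own i w) : v = w := by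
  ext l
  exact congrArg (fun u => u ⟨l, rfl⟩) (h (own l))

end

namespace SaddleProblem

variable {n m p N₁ N₂ : ℕ} {S : SaddleProblem n m p}
  {σ : Fin n ⊕ Fin m → Fin N₁} {τ : Fin p → Fin N₂} {B : ℕ} {γ β : ℝ}
  {K : Fin N₁ → Set ℕ} {D : Set ℕ} {R : AgentStates n m p N₁ N₂}

namespace IsRun

theorem block_gradient_primal (hR : S.IsRun σ τ B γ β K D R) (i : Fin N₁) (k : ℕ) :
    block σ i (gradient (fun z => S.L z (R.lP i k)) (R.zP i k)) =
      block σ i (gradient (fun z => S.L z (R.lam τ k)) (R.z σ k)) := by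
  simp only [gradient_L_primal, block_add, block_smul, AgentStates.block_z]
  congr 2
  ext ⟨l, hl⟩
  simp only [block_apply, ATmap_apply]
  refine Finset.sum_congr rfl fun j _ => ?_
  by_cases hA : S.A j l = 0
  · simp [hA]
  · have h := hR.dual_to_primal i (τ j) ⟨l, j, hl, rfl, hA⟩ k
    rw [← AgentStates.block_lam] at h
    have h' := congrArg (fun u => u ⟨j, rfl⟩) h
    simp only [block_apply] at h'
    rw [h']

theorem block_gradient_dual (hR : S.IsRun σ τ B γ β K D R) (q : Fin N₂) {t : ℕ} (ht : t ∈ D)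
    (k : ℕ) :
    block τ q (gradient (fun l => S.L (R.zD q (t * B)) l) (R.lD q k)) =
      block τ q (gradient (fun l => S.L (R.z σ (t * B)) l) (R.lam τ k)) := by
  simp only [gradient_L_dual, block_sub, block_smul, AgentStates.block_lam]
  congr 1
  ext ⟨j, hj⟩
  simp only [block_apply, gvec, g]
  congr 3
  refine Finset.sum_congr rfl fun l _ => ?_
  by_cases hA : S.A j l = 0
  · simp [hA]
  · have h := hR.primal_to_dual (σ l) q ⟨l, j, rfl, hj, hA⟩ t ht
    rw [← AgentStates.block_z] at h
    have h' := congrArg (fun u => u ⟨l, rfl⟩) h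
    simp only [block_apply] at h'
    rw [h']

theorem primal_step (hR : S.IsRun σ τ B γ β K D R) (i : Fin N₁) (k : ℕ) (hk : k ∈ K i) :
    IsProjOnto (S.Zblock σ i)
      (block σ i (R.z σ k) - γ • block σ i (gradient (fun z => S.L z (R.lam τ k)) (R.z σ k)))
      (block σ i (R.z σ (k + 1))) := by
  rw [← hR.block_gradient_primal, AgentStates.block_z, AgentStates.block_z]
  exact hR.primal_update i k hk

theorem primal_const (hR : S.IsRun σ τ B γ β K D R) (i : Fin N₁) (k : ℕ) (hk : k ∉ K i) :
    block σ i (R.z σ (k + 1)) = block σ i (R.z σ k) := by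
  rw [AgentStates.block_z, AgentStates.block_z]
  exact hR.primal_hold i k hk

theorem dual_step (hR : S.IsRun σ τ B γ β K D R) (q : Fin N₂) {t : ℕ} (ht : t ∈ D) :
    IsProjOnto (S.Lamblock τ q)
      (block τ q (R.lam τ (t * B - 1)) +
        β • block τ q (gradient (fun l => S.L (R.z σ (t * B)) l) (R.lam τ (t * B - 1))))
      (block τ q (R.lam τ (t * B))) := by
  rw [← hR.block_gradient_dual q ht, AgentStates.block_lam, AgentStates.block_lam]
  exact hR.dual_update q t ht

theorem lam_succ_eq (hR : S.IsRun σ τ B γ β K D R) {k : ℕ} (hk : ¬ ∃ t ∈ D, k + 1 = t * B) :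
    R.lam τ (k + 1) = R.lam τ k := by
  refine ext_block (own := τ) fun q => ?_
  rw [AgentStates.block_lam, AgentStates.block_lam]
  exact hR.dual_hold q k hk

theorem z_mem (hR : S.IsRun σ τ B γ β K D R) (k : ℕ) : R.z σ k ∈ S.Z S.ξ := by
  refine mem_Z_of_block (σ := σ) fun i => ?_
  induction k with
  | zero =>
    rw [AgentStates.block_z]
    exact hR.primal_init i
  | succ k ih =>
    by_cases hk : k ∈ K i
    · exact (hR.primal_step i k hk).1
    · rw [hR.primal_const i k hk]; exact ih

theorem lam_mem (hR : S.IsRun σ τ B γ β K D R) (k : ℕ) : R.lam τ k ∈ S.LamProd τ := by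
  induction k with
  | zero =>
    intro q
    rw [AgentStates.block_lam]
    exact hR.dual_init q
  | succ k ih =>
    by_cases hk : ∃ t ∈ D, k + 1 = t * B
    · obtain ⟨t, ht, hkt⟩ := hk
      intro q
      rw [hkt]
      exact (hR.dual_step q ht).1
    · rw [hR.lam_succ_eq hk]; exact ih

/-- The multipliers are constant between two consecutive multiples of `B`. -/
theorem lam_add_eq (hR : S.IsRun σ τ B γ β K D R) (t : ℕ) {k : ℕ} (hk : k < B) :
    R.lam τ (t * B + k) = R.lam τ (t * B) := by
  induction k with
  | zero => rfl
  | succ k ih =>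
    rw [← ih (Nat.lt_of_succ_lt hk), ← add_assoc]
    refine hR.lam_succ_eq ?_
    rintro ⟨u, _, hu⟩
    have h1 : t * B < u * B := by omega
    have h2 : u * B < (t + 1) * B := by rw [Nat.succ_mul]; omega
    have h3 := Nat.lt_of_mul_lt_mul_right h1
    have h4 := Nat.lt_of_mul_lt_mul_right h2
    omega

theorem lam_succ_mul_eq (hR : S.IsRun σ τ B γ β K D R) (hB : 1 ≤ B) {t : ℕ} (ht : t + 1 ∉ D) :
    R.lam τ ((t + 1) * B) = R.lam τ (t * B) := by
  have h : (t + 1) * B = t * B + (B - 1) + 1 := by rw [Nat.succ_mul]; omega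
  rw [h, hR.lam_succ_eq, hR.lam_add_eq t (by omega)]
  rintro ⟨u, hu, hut⟩
  rw [← h] at hut
  have := Nat.eq_of_mul_eq_mul_right (by omega) hut
  exact ht (this ▸ hu)

/-- Within one window of length `B` the primal iterate approaches the minimiser for the current
multipliers. -/
theorem norm_z_sub_le (hR : S.IsRun σ τ B γ β K D R) (hK : PartiallyAsync B K) {γ₁ θ : ℝ}
    (hrate : S.IsPrimalRate σ τ B γ₁ θ) (hγ : γ ∈ Set.Ioo 0 γ₁) (t : ℕ) {zh : PVec n m}
    (hzh : zh ∈ S.Z S.ξ)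
    (hmin : IsMinOn (fun w => S.L w (R.lam τ (t * B))) (S.Z S.ξ) zh) :
    ‖R.z σ ((t + 1) * B) - zh‖ ≤ (1 - θ * γ) * ‖R.z σ (t * B) - zh‖ := by
  have h := (hrate.2.2 γ hγ).2 (R.lam τ (t * B)) (hR.lam_mem _) (fun i => {k | t * B + k ∈ K i})
    (fun i k => by
      obtain ⟨j, hj, h1, h2⟩ := hK i (t * B + k)
      refine ⟨j - t * B, ?_, by omega, by omega⟩
      rw [Set.mem_ofPred_eq, Nat.add_sub_cancel' (by omega)]
      exact hj)
    (fun k => R.z σ (t * B + k)) (hR.z_mem _) 1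
    (fun i k hk => by
      rw [one_mul] at hk
      refine ⟨fun hkK => ?_, fun hkK => hR.primal_const i _ hkK⟩
      have := hR.primal_step i _ hkK
      rwa [hR.lam_add_eq t hk] at this) zh hzh hmin
  rwa [pow_one, one_mul, add_zero, ← Nat.succ_mul] at h

theorem dual_step_le (hR : S.IsRun σ τ B γ β K D R) (hB : 1 ≤ B) (hK : PartiallyAsync B K)
    (hZ : IsCompact (S.Z S.ξ)) (hZc : Convex ℝ (S.Z S.ξ)) (hα : 0 < S.α)
    {zh : PVec n m} {lh : DVec p} (hzh : zh ∈ S.Z S.ξ) (hlh : lh ∈ S.LamProd τ)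
    (hsad : IsSaddlePointOn (S.Z S.ξ) (S.LamProd τ) S.L zh lh)
    {γ₁ θ : ℝ} (hrate : S.IsPrimalRate σ τ B γ₁ θ) (hγ : γ ∈ Set.Ioo 0 γ₁) (hβ : 0 < β)
    (hqd : (1 - β * S.δ) ^ 2 + β ^ 2 ≤ 1)
    (hcase : β * (‖S.A‖ ^ 2 + 2 * S.α * S.δ) ≤ 2 * S.α ∨
      1 - (1 - θ * γ) ^ 2 ≤ 2 * β ^ 2 * (1 - θ * γ)) {t : ℕ} (ht : t + 1 ∈ D) :
    ‖R.lam τ ((t + 1) * B) - lh‖ ^ 2 ≤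
      ((1 - β * S.δ) ^ 2 + β ^ 2) * ‖R.lam τ (t * B) - lh‖ ^ 2 +
      (4 * S.r ^ 2 * ((1 - β * S.δ) ^ 2 + β ^ 2) * (1 - θ * γ) ^ 2 * ‖S.A‖ ^ 2 +
        8 * S.r ^ 2 * β ^ 2 * (1 - θ * γ) * ‖S.A‖ ^ 2) := by
  obtain ⟨zt, hzt, hztmin⟩ := hZ.exists_isMinOn ⟨zh, hzh⟩
    (S.continuous_L_primal (R.lam τ (t * B))).continuousOn
  have hqp := (hrate.2.2 γ hγ).1
  set z := R.z σ ((t + 1) * B) with hz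
  have hzmem : z ∈ S.Z S.ξ := hR.z_mem _
  have hr : 0 ≤ S.r := (norm_nonneg _).trans (norm_le_r hZ hzh)
  have hprev : R.lam τ ((t + 1) * B - 1) = R.lam τ (t * B) := by
    rw [← hR.lam_add_eq t (k := B - 1) (by omega)]
    congr 1
    rw [Nat.succ_mul]
    omega
  have hmax := S.inner_nonpos_of_isMaxOn (convex_LamProd τ) hlh (fun l hl => hsad zh hzh l hl)
    (hR.lam_mem ((t + 1) * B))
  have hproj : inner ℝ (R.lam τ (t * B) + β • (S.gvec z - S.δ • R.lam τ (t * B)) -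
      R.lam τ ((t + 1) * B)) (lh - R.lam τ ((t + 1) * B)) ≤ 0 := by
    rw [← sum_inner_block τ]
    refine Finset.sum_nonpos fun q _ => ?_
    have h := (hR.dual_step q ht).inner_le_zero (convex_Lamblock τ q) (hlh q)
    rwa [gradient_L_dual, hprev] at h
  have hnorm : ‖R.lam τ ((t + 1) * B) - lh‖ ≤
      ‖(1 - β * S.δ) • (R.lam τ (t * B) - lh) + β • S.Amap ((z - zt) + (zt - zh))‖ := by
    refine norm_le_of_sq_le_inner ?_
    have h2 := mul_nonpos_of_nonneg_of_nonpos hβ.le hmax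
    rw [← real_inner_smul_left] at h2
    rw [← neg_sub (R.lam τ ((t + 1) * B)) lh, inner_neg_right] at hproj
    rw [sub_add_sub_cancel, ← gvec_sub, ← real_inner_self_eq_norm_sq]
    have : inner ℝ ((1 - β * S.δ) • (R.lam τ (t * B) - lh) + β • (S.gvec z - S.gvec zh))
          (R.lam τ ((t + 1) * B) - lh) -
        inner ℝ (R.lam τ ((t + 1) * B) - lh) (R.lam τ ((t + 1) * B) - lh) =
        inner ℝ (R.lam τ (t * B) + β • (S.gvec z - S.δ • R.lam τ (t * B)) -
          R.lam τ ((t + 1) * B)) (R.lam τ ((t + 1) * B) - lh) -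
        inner ℝ (β • (S.gvec zh - S.δ • lh)) (R.lam τ ((t + 1) * B) - lh) := by
      rw [← inner_sub_left, ← inner_sub_left]
      congr 1
      simp only [sub_smul, smul_sub, one_smul, smul_smul]
      abel
    linarith
  have he : ‖z - zt‖ ≤ 2 * S.r * (1 - θ * γ) := by
    refine (hR.norm_z_sub_le hK hrate hγ t hzt hztmin).trans ?_
    rw [mul_comm]
    exact mul_le_mul_of_nonneg_right (norm_sub_le_two_r hZ (hR.z_mem _) hzt) hqp.1
  refine (pow_le_pow_left₀ (norm_nonneg _) hnorm 2).trans ?_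
  exact sq_norm_dual_step_le S.Amap S.norm_Amap_le (norm_nonneg _) hα hβ hr hqp.1 he
    (norm_sub_le_two_r hZ hzt hzh)
    (by rw [sub_add_sub_cancel]; exact norm_sub_le_two_r hZ hzmem hzh)
    (S.inner_Amap_sub_le hZc hzt hzh hztmin fun w hw => hsad w hw lh hlh) hqd hcase

end IsRun

theorem ncard_inter_Iic_succ {D : Set ℕ} {t : ℕ} (ht : t + 1 ∈ D) :
    (D ∩ Set.Iic (t + 1)).ncard = (D ∩ Set.Iic t).ncard + 1 := by
  have h : D ∩ Set.Iic (t + 1) = insert (t + 1) (D ∩ Set.Iic t) := by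
    ext k
    simp only [Set.mem_inter_iff, Set.mem_Iic, Set.mem_insert_iff]
    constructor
    · rintro ⟨hk, hkt⟩
      rcases Nat.lt_or_ge t k with h | h
      · exact Or.inl (by omega)
      · exact Or.inr ⟨hk, h⟩
    · rintro (rfl | ⟨hk, hkt⟩)
      · exact ⟨ht, le_rfl⟩
      · exact ⟨hk, by omega⟩
  rw [h, Set.ncard_insert_of_notMem (fun h => absurd h.2 (by simp))
    ((Set.finite_Iic t).inter_of_right D)]

theorem inter_Iic_succ_of_notMem {D : Set ℕ} {t : ℕ} (ht : t + 1 ∉ D) :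
    D ∩ Set.Iic (t + 1) = D ∩ Set.Iic t := by
  ext k
  simp only [Set.mem_inter_iff, Set.mem_Iic]
  refine ⟨fun ⟨hk, hkt⟩ => ⟨hk, ?_⟩, fun ⟨hk, hkt⟩ => ⟨hk, by omega⟩⟩
  have : k ≠ t + 1 := fun h => ht (h ▸ hk)
  omega

/-- A sequence that is contracted up to an error `C` at the indices in `D` and constant
elsewhere. -/
theorem le_pow_mul_add_geom_sum {e : ℕ → ℝ} {q C : ℝ} (hq : 0 ≤ q) {D : Set ℕ}
    (h0 : 0 ∉ D) (hup : ∀ t, t + 1 ∈ D → e (t + 1) ≤ q * e t + C)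
    (hhold : ∀ t, t + 1 ∉ D → e (t + 1) = e t) (t : ℕ) :
    e t ≤ q ^ (D ∩ Set.Iic t).ncard * e 0 +
      C * ∑ i ∈ Finset.range (D ∩ Set.Iic t).ncard, q ^ i := by
  induction t with
  | zero =>
    have : D ∩ Set.Iic 0 = ∅ := by
      ext k
      simp only [Set.mem_inter_iff, Set.mem_Iic, Set.mem_empty_iff_false, iff_false]
      rintro ⟨hk, hk0⟩
      exact h0 (Nat.le_zero.mp hk0 ▸ hk)
    simp [this]
  | succ t ih =>
    by_cases ht : t + 1 ∈ D
    · rw [ncard_inter_Iic_succ ht, geom_sum_succ]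
      have := mul_le_mul_of_nonneg_left ih hq
      refine (hup t ht).trans ?_
      rw [pow_succ]
      linarith
    · rw [hhold t ht, inter_Iic_succ_of_notMem ht]
      exact ih

theorem dualEstimate_of_saddle (hB : 1 ≤ B) (hZ : IsCompact (S.Z S.ξ)) (hZc : Convex ℝ (S.Z S.ξ))
    (hα : 0 < S.α) {zh : PVec n m} {lh : DVec p} (hzh : zh ∈ S.Z S.ξ)
    (hlh : lh ∈ S.LamProd τ) (hsad : IsSaddlePointOn (S.Z S.ξ) (S.LamProd τ) S.L zh lh)
    {γ₁ θ M : ℝ} (hrate : S.IsPrimalRate σ τ B γ₁ θ)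
    (hcase : ∀ γ ∈ Set.Ioo 0 γ₁, ∀ β > 0, β < 2 * S.α / (M + 2 * S.α * S.δ) →
      β * (‖S.A‖ ^ 2 + 2 * S.α * S.δ) ≤ 2 * S.α ∨
        1 - (1 - θ * γ) ^ 2 ≤ 2 * β ^ 2 * (1 - θ * γ)) :
    S.DualEstimate σ τ B γ₁ θ M lh := by
  rintro γ hγ β hβ hβlt _ _ rfl rfl
  have hqp := (hrate.2.2 γ hγ).1
  have hqd0 : 0 ≤ (1 - β * S.δ) ^ 2 + β ^ 2 := by positivity
  have hqd1 : (1 - β * S.δ) ^ 2 + β ^ 2 < 1 := by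
    have h := hβlt.trans_le (min_le_right _ _)
    rw [lt_div_iff₀ (by positivity)] at h
    have := mul_pos hβ (sub_pos.mpr h)
    linarith
  refine ⟨⟨hqd0, hqd1⟩, hqp, ?_⟩
  rintro K D hK h0 R hR _ t _ rfl
  have h := le_pow_mul_add_geom_sum (e := fun t => ‖R.lam τ (t * B) - lh‖ ^ 2) hqd0 h0
    (fun t ht => hR.dual_step_le hB hK hZ hZc hα hzh hlh hsad hrate hγ hβ hqd1.le
      (hcase γ hγ β hβ (hβlt.trans_le (min_le_left _ _))) ht)
    (fun t ht => by simp only [hR.lam_succ_mul_eq hB ht]) t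
  simp only [zero_mul] at h
  refine h.trans ?_
  have hC : 0 ≤ 4 * S.r ^ 2 * ((1 - β * S.δ) ^ 2 + β ^ 2) * (1 - θ * γ) ^ 2 * ‖S.A‖ ^ 2 +
      8 * S.r ^ 2 * β ^ 2 * (1 - θ * γ) * ‖S.A‖ ^ 2 := by
    have := hqp.1
    positivity
  gcongr
  exact Nat.le_succ _

/-- Dual stepsizes beyond `2 α / (‖A‖² + 2 α δ)` are bounded below, so that all sufficiently small
primal stepsizes leave room for the primal error in the estimate. -/
theorem exists_primalRate_dualEstimate (hB : 1 ≤ B) (hZ : IsCompact (S.Z S.ξ))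
    (hZc : Convex ℝ (S.Z S.ξ)) (hZi : ∀ i, Convex ℝ (S.Zblock σ i)) (hα : 0 < S.α)
    (hδ : 0 < S.δ) {zh : PVec n m} {lh : DVec p} (hzh : zh ∈ S.Z S.ξ)
    (hlh : lh ∈ S.LamProd τ) (hsad : IsSaddlePointOn (S.Z S.ξ) (S.LamProd τ) S.L zh lh) (M : ℝ) :
    ∃ γ₁ θ : ℝ, S.IsPrimalRate σ τ B γ₁ θ ∧ S.DualEstimate σ τ B γ₁ θ M lh := by
  set b := 2 * S.α / (‖S.A‖ ^ 2 + 2 * S.α * S.δ) with hb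
  have hden : 0 < ‖S.A‖ ^ 2 + 2 * S.α * S.δ := by positivity
  have hb0 : 0 < b := by positivity
  set ε := min (1 / 2) (b ^ 2 / 2) with hε
  have hε0 : 0 < ε := by positivity
  have hε1 : ε ≤ 1 / 2 := min_le_left _ _
  have hε2 : ε ≤ b ^ 2 / 2 := min_le_right _ _
  have hαε : S.α * (ε / S.α) = ε := by field_simp
  have hrate : S.IsPrimalRate σ τ B (ε / S.α) S.α :=
    isPrimalRate_of_le σ τ B hZc hZi hα (by positivity) (by linarith)
  refine ⟨_, _, hrate, dualEstimate_of_saddle hB hZ hZc hα hzh hlh hsad hrate ?_⟩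
  intro γ hγ β hβ _
  rcases le_total β b with h | h
  · left
    rwa [hb, le_div_iff₀ hden] at h
  · right
    have h1 : S.α * γ ≤ ε := (mul_le_mul_of_nonneg_left hγ.2.le hα.le).trans hαε.le
    have h2 : b ^ 2 ≤ β ^ 2 := by gcongr
    have h3 : β ^ 2 * (1 / 2) ≤ β ^ 2 * (1 - S.α * γ) := by gcongr; linarith
    have h4 := sq_nonneg (S.α * γ)
    linarith

end SaddleProblem

end

theorem theorem4 {n m p N₁ N₂ : ℕ} (S : SaddleProblem n m p)
    (σ : Fin n ⊕ Fin m → Fin N₁) (τ : Fin p → Fin N₂)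
    (hX_nonempty : S.setX.Nonempty) (hX_compact : IsCompact S.setX) (hX_convex : Convex ℝ S.setX)
    (hslater : S.IsSlaterPoint S.zbar)
    (hξ : S.ξ ∈ Set.Ico S.xiE 1) (hα : 0 < S.α) (hδ : 0 < S.δ) (hφ : 0 ≤ S.φ)
    (B : ℕ) (hB : 1 ≤ B) :
    (∃! w : PVec n m × DVec p, S.IsSaddle w.1 w.2) ∧
    ∀ (zh : PVec n m) (lh : DVec p), S.IsSaddle zh lh →
      (∀ γ₁ θ : ℝ, S.IsPrimalRate σ τ B γ₁ θ → S.DualEstimate σ τ B γ₁ θ (‖S.A‖ ^ 2) lh) ∧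
      (∃ γ₁ θ : ℝ, S.IsPrimalRate σ τ B γ₁ θ ∧ S.DualEstimate σ τ B γ₁ θ ‖S.A‖ lh) := by
  have hZ := SaddleProblem.isCompact_Z hX_nonempty hX_compact
  have hZc := SaddleProblem.convex_Z hX_nonempty hX_convex
  obtain ⟨z₀, l₀, h₀, hprod⟩ := SaddleProblem.exists_isSaddle τ hZ hZc hslater hξ.1 hα hδ hφ
  have huniq : ∀ zh lh, S.IsSaddle zh lh → zh = z₀ ∧ lh = l₀ := fun zh lh h =>
    SaddleProblem.eq_of_isSaddle hZc hα hδ SaddleProblem.convex_Lam h.1 h₀.1 h.2.1 h₀.2.1 h.2.2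
      h₀.2.2
  refine ⟨⟨(z₀, l₀), h₀, fun w hw => Prod.ext (huniq _ _ hw).1 (huniq _ _ hw).2⟩, ?_⟩
  intro zh lh h
  obtain ⟨rfl, rfl⟩ := huniq zh lh h
  have hl := SaddleProblem.Lam_subset_LamProd τ h.2.1
  refine ⟨fun γ₁ θ hrate => ?_, ?_⟩
  · refine SaddleProblem.dualEstimate_of_saddle hB hZ hZc hα h.1 hl hprod hrate ?_
    intro γ _ β _ hβ
    rw [lt_div_iff₀ (by positivity)] at hβ
    exact Or.inl hβ.le
  · exact SaddleProblem.exists_primalRate_dualEstimate hB hZ hZc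
      (SaddleProblem.convex_Zblock hX_nonempty hX_convex σ) hα hδ h.1 hl hprod _
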